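/- For an integer $n\ge 0$ let $P_n$ be the Chebyshev polynomial of the second kind scaled on $]-2,2[$, i.e. the real polynomial of degree $n$ with $$P_n(x)=\frac{\sin\left((n+1)\arccos\frac{x}{2}\right)}{\sqrt{1-\frac{x^2}{4}}},\qquad x\in\,]-2,2[.$$ Let $K\ge 1$, let $i_1,\dots,i_K$ be positive integers, let $p\in\{0,1\}$, and let $$h(x)=\prod_{k=1}^{K}P_{2i_k}(x)+(-1)^p .$$ Then all complex roots of $h$ are real if and only if one of the following three cases holds: (a) $K=1$; (b) $K=2$, $i_1=i_2$ and $p=1$; (c) $K=2$, $|i_1-i_2|=1$ and $p=0$. Moreover, the roots of $h$ in these cases, each listed as often as its multiplicity (where $\pm y$ stands for the two entries $y$ and $-y$, so that $\pm 0$ is the entry $0$ twice), are: in case (a), with $j=i_1$: $\ \pm 2\cos\dfrac{\pi k}{2j+1+(-1)^{k+p}}$, $\ k=1,\dots,j$; in case (b), with $j=i_1$: $\ \pm 2\cos\dfrac{\pi k}{2j}$ and $\pm 2\cos\dfrac{\pi k}{2j+2}$, $\ k=1,\dots,j$; in case (c), with $j=\max(i_1,i_2)$: $\ \pm 2\cos\dfrac{\pi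 k}{2j}$, $\ k=1,\dots,2j-1$ (so every root of $h$ that occurs here has multiplicity $2$). -/

import Mathlib

open Polynomial

/-- The Chebyshev polynomial of the second kind scaled on `]-2, 2[`, i.e. the polynomial `P n` of
degree `n` with `P n (2 cos φ) = sin ((n + 1) φ) / sin φ` for `φ ∈ ]0, π[`. -/
noncomputable def chebP (n : ℕ) : ℝ[X] := Polynomial.Chebyshev.S ℝ (n : ℤ)

/-- The trigonometric formula that characterizes `chebP`. -/
theorem chebP_eval (n : ℕ) (x : ℝ) (hx : x ∈ Set.Ioo (-2 : ℝ) 2) :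
    (chebP n).eval x =
      Real.sin (((n : ℝ) + 1) * Real.arccos (x / 2)) / Real.sqrt (1 - x ^ 2 / 4) := by
  have hx1 : -2 < x := hx.1
  have hx2 : x < 2 := hx.2
  have hpos : 0 < 1 - x ^ 2 / 4 := by nlinarith
  have hs : Real.sin (Real.arccos (x / 2)) = Real.sqrt (1 - x ^ 2 / 4) := by
    rw [Real.sin_arccos]
    congr 1
    ring
  have hc : Real.cos (Real.arccos (x / 2)) = x / 2 :=
    Real.cos_arccos (by linarith) (by linarith)
  have hU := Polynomial.Chebyshev.U_real_cos (Real.arccos (x / 2)) (n : ℤ)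
  rw [← Polynomial.Chebyshev.S_comp_two_mul_X, Polynomial.eval_comp, hc, hs] at hU
  rw [eq_div_iff (Real.sqrt_pos.2 hpos).ne', chebP]
  simpa [mul_div_cancel₀] using hU

/-- The polynomial `h(x) = ∏_{k=1}^K P_{2 i_k}(x) + (-1)^p`. -/
noncomputable def chebH (K : ℕ) (i : ℕ → ℕ) (p : ℕ) : ℝ[X] :=
  (∏ k ∈ Finset.Icc 1 K, chebP (2 * i k)) + (-1) ^ p

/-- A real polynomial has only real roots: each of its complex roots is real. -/
def HasOnlyRealRoots (f : ℝ[X]) : Prop :=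
  ∀ z : ℂ, aeval z f = 0 → z.im = 0

/-- The two numbers `± 2 cos θ`, as a multiset (so that `± 0` is listed twice). -/
noncomputable def pmTwoCos (θ : ℝ) : Multiset ℝ :=
  {2 * Real.cos θ, -(2 * Real.cos θ)}

/-! Put x = z + 1/z. Up to a power of z, h becomes Q(z²) with Q a monic integer polynomial, Q(0) = 1
and Q > 0 on the positive reals. If h has only real roots, each such z is real or of modulus 1; real
z would make z² a positive root of Q, so all roots of Q lie on the unit circle and, by Kronecker,
are roots of unity. If a root has order n, its conjugate exp(2πi/n) is also a root, and taking norms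
gives ∏ |sin((2i_k+1)π/n)| / sin(π/n) = 1. Every factor is at least 1, hence 2i_k+1 ≡ ±1 mod n for
all k. So each root of h is 2 cos θ with 2i_kθ or (2i_k+2)θ in πℤ for every k
(`exists_angle_of_root`).

This rigidity is tested at the largest roots. For p = 1 some root exceeds all zeros of the factors,
which forces all i_k to be equal; then h = S^K - 1, which has a nonconstant factor without real
zeros when K ≥ 3. For p = 0 and K ≥ 2, exactly one factor has a zero above the top root of h; the
top root is double, and comparing values and derivatives of the factors there gives K = 2 and
consecutive indices.

Conversely, P_{2j} ± 1 splits as some P_a times some C_b, where C_b(2 cos θ) = 2 cos bθ, and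
P_{2j}P_{2j+2} + 1 = P_{2j+1}². The explicit root lists follow, and counting them shows that all
roots are real. -/

theorem chebP_natDegree_monic (n : ℕ) : (chebP n).natDegree = n ∧ (chebP n).Monic := by
  have h2 : (2 * X : ℝ[X]) = C 2 * X := by rw [map_ofNat]
  have hd2 : (2 * X : ℝ[X]).natDegree = 1 := by rw [h2]; exact natDegree_C_mul_X 2 two_ne_zero
  have hl2 : (2 * X : ℝ[X]).leadingCoeff = 2 := by rw [h2]; simp
  have hc := Chebyshev.S_comp_two_mul_X ℝ (n : ℤ)
  have hd : (chebP n).natDegree = n := by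
    have := congrArg natDegree hc
    rw [natDegree_comp, hd2, mul_one, Chebyshev.natDegree_U_natCast] at this
    exact this
  refine ⟨hd, ?_⟩
  have := congrArg leadingCoeff hc
  rw [leadingCoeff_comp (by rw [hd2]; exact one_ne_zero), hl2, Chebyshev.leadingCoeff_U_natCast]
    at this
  change (chebP n).leadingCoeff * 2 ^ (chebP n).natDegree = 2 ^ n at this
  rw [hd] at this
  exact mul_right_cancel₀ (pow_ne_zero n two_ne_zero) (this.trans (one_mul _).symm)

theorem chebP_natDegree (n : ℕ) : (chebP n).natDegree = n := (chebP_natDegree_monic n).1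

theorem chebP_monic (n : ℕ) : (chebP n).Monic := (chebP_natDegree_monic n).2

/-! ### The reciprocal integer polynomial -/

theorem aeval_chebP_add_inv {z : ℂ} (hz : z ≠ 0) (n : ℕ) :
    aeval (z + z⁻¹) (chebP n) * z ^ n = ∑ l ∈ Finset.range (n + 1), (z ^ 2) ^ l := by
  have key : ∀ n : ℕ, (Chebyshev.S ℂ n).eval (z + z⁻¹) * z ^ n =
        ∑ l ∈ Finset.range (n + 1), (z ^ 2) ^ l ∧
      (Chebyshev.S ℂ (n + 1 : ℕ)).eval (z + z⁻¹) * z ^ (n + 1) =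
        ∑ l ∈ Finset.range (n + 2), (z ^ 2) ^ l := by
    intro n
    induction n with
    | zero =>
      refine ⟨by simp, ?_⟩
      simp [Finset.sum_range_succ]
      field_simp
      ring
    | succ n ih =>
      refine ⟨ih.2, ?_⟩
      have e : ((n + 1 + 1 : ℕ) : ℤ) = (n : ℤ) + 2 := by push_cast; ring
      have e1 : ((n + 1 : ℕ) : ℤ) = (n : ℤ) + 1 := by push_cast; ring
      have h1 := ih.2
      rw [e1] at h1
      rw [e, Chebyshev.S_add_two, eval_sub, eval_mul, eval_X]
      have : ((z + z⁻¹) * eval (z + z⁻¹) (Chebyshev.S ℂ (n + 1)) -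
          eval (z + z⁻¹) (Chebyshev.S ℂ n)) * z ^ (n + 1 + 1) =
          (z ^ 2 + 1) * (eval (z + z⁻¹) (Chebyshev.S ℂ (n + 1)) * z ^ (n + 1)) -
          z ^ 2 * (eval (z + z⁻¹) (Chebyshev.S ℂ n) * z ^ n) := by
        field_simp
        ring
      rw [this, h1, ih.1, Finset.sum_range_succ _ (n + 2), Finset.sum_range_succ _ (n + 1)]
      ring
  rw [chebP, Chebyshev.aeval_S]
  exact (key n).1

/-- The integer polynomial `Q` with `h (z + z⁻¹) * z ^ deg h = Q (z ^ 2)` for `h = chebH K i p`. -/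
noncomputable def reciprocalH (K : ℕ) (i : ℕ → ℕ) (p : ℕ) : ℤ[X] :=
  (∏ k ∈ Finset.Icc 1 K, ∑ l ∈ Finset.range (2 * i k + 1), X ^ l) +
    (-1) ^ p * X ^ (∑ k ∈ Finset.Icc 1 K, i k)

theorem aeval_reciprocalH {A : Type*} [CommRing A] (K : ℕ) (i : ℕ → ℕ) (p : ℕ) (w : A) :
    aeval w (reciprocalH K i p) =
      (∏ k ∈ Finset.Icc 1 K, ∑ l ∈ Finset.range (2 * i k + 1), w ^ l) +
        (-1) ^ p * w ^ (∑ k ∈ Finset.Icc 1 K, i k) := by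
  simp [reciprocalH, map_prod]

theorem aeval_chebH_add_inv {z : ℂ} (hz : z ≠ 0) (K : ℕ) (i : ℕ → ℕ) (p : ℕ) :
    aeval (z + z⁻¹) (chebH K i p) * z ^ (∑ k ∈ Finset.Icc 1 K, 2 * i k) =
      aeval (z ^ 2) (reciprocalH K i p) := by
  rw [aeval_reciprocalH, chebH, map_add, map_prod, map_pow, map_neg, map_one, add_mul]
  congr 1
  · rw [← Finset.prod_pow_eq_pow_sum, ← Finset.prod_mul_distrib]
    exact Finset.prod_congr rfl fun k _ => aeval_chebP_add_inv hz _
  · rw [← Finset.mul_sum, pow_mul]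

theorem chebH_root_iff {z : ℂ} (hz : z ≠ 0) (K : ℕ) (i : ℕ → ℕ) (p : ℕ) :
    aeval (z + z⁻¹) (chebH K i p) = 0 ↔ aeval (z ^ 2) (reciprocalH K i p) = 0 := by
  rw [← aeval_chebH_add_inv hz, mul_eq_zero, or_iff_left (pow_ne_zero _ hz)]

section

variable {K : ℕ} {i : ℕ → ℕ}

theorem monic_reciprocalH (hK : 1 ≤ K) (hi : ∀ k ∈ Finset.Icc 1 K, 0 < i k) (p : ℕ) :
    (reciprocalH K i p).Monic := by
  have hg : ∀ n : ℕ, (∑ l ∈ Finset.range (n + 1), (X : ℤ[X]) ^ l).Monic ∧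
      (∑ l ∈ Finset.range (n + 1), (X : ℤ[X]) ^ l).natDegree = n := by
    intro n
    refine ⟨monic_geom_sum_X n.succ_ne_zero, ?_⟩
    have := (monic_X_sub_C (1 : ℤ)).natDegree_mul (monic_geom_sum_X (R := ℤ) n.succ_ne_zero)
    rw [C_1, mul_geom_sum, ← C_1, natDegree_X_pow_sub_C, natDegree_X_sub_C] at this
    simp only [Nat.succ_eq_add_one] at this
    omega
  have hm : (∏ k ∈ Finset.Icc 1 K, ∑ l ∈ Finset.range (2 * i k + 1), (X : ℤ[X]) ^ l).Monic :=
    monic_prod_of_monic _ _ fun k _ => (hg _).1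
  refine hm.add_of_left ?_
  have hlt : ∑ k ∈ Finset.Icc 1 K, i k < ∑ k ∈ Finset.Icc 1 K, 2 * i k :=
    Finset.sum_lt_sum_of_nonempty ⟨1, Finset.mem_Icc.2 ⟨le_rfl, hK⟩⟩
      fun k hk => by have := hi k hk; omega
  have e : ((-1) ^ p * X ^ (∑ k ∈ Finset.Icc 1 K, i k) : ℤ[X]) =
      C ((-1) ^ p) * X ^ (∑ k ∈ Finset.Icc 1 K, i k) := by simp
  rw [e]
  refine (degree_C_mul_X_pow_le _ _).trans_lt ?_
  rw [degree_eq_natDegree hm.ne_zero, natDegree_prod_of_monic _ _ fun k _ => (hg _).1]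
  simp only [(hg _).2]
  exact_mod_cast hlt

/-- Each geometric sum strictly exceeds its middle term s^{i_k}, so the product exceeds s^{∑ i_k}
and survives even a minus sign. -/
theorem aeval_reciprocalH_pos (hK : 1 ≤ K) (hi : ∀ k ∈ Finset.Icc 1 K, 0 < i k) (p : ℕ)
    {s : ℝ} (hs : 0 < s) : 0 < aeval s (reciprocalH K i p) := by
  rw [aeval_reciprocalH]
  have hlt : ∏ k ∈ Finset.Icc 1 K, s ^ i k <
      ∏ k ∈ Finset.Icc 1 K, ∑ l ∈ Finset.range (2 * i k + 1), s ^ l := by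
    refine Finset.prod_lt_prod_of_nonempty (fun k _ => pow_pos hs _) (fun k hk => ?_)
      ⟨1, Finset.mem_Icc.2 ⟨le_rfl, hK⟩⟩
    have := hi k hk
    refine Finset.single_lt_sum (i := i k) (j := 0) (by omega) (by simp; omega) (by simp) (by simp)
      fun l _ _ => (pow_pos hs l).le
  rw [Finset.prod_pow_eq_pow_sum] at hlt
  rcases neg_one_pow_eq_or ℝ p with h | h <;> rw [h]
  · have := pow_pos hs (∑ k ∈ Finset.Icc 1 K, i k)
    linarith
  · linarith

theorem aeval_reciprocalH_ofReal_ne_zero (hK : 1 ≤ K) (hi : ∀ k ∈ Finset.Icc 1 K, 0 < i k)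
    (p : ℕ) {s : ℝ} (hs : 0 < s) : aeval (s : ℂ) (reciprocalH K i p) ≠ 0 := by
  have := aeval_algebraMap_apply ℂ s (reciprocalH K i p)
  rw [Complex.coe_algebraMap] at this
  rw [this]
  exact_mod_cast (aeval_reciprocalH_pos hK hi p hs).ne'

theorem aeval_zero_reciprocalH (hK : 1 ≤ K) (hi : ∀ k ∈ Finset.Icc 1 K, 0 < i k) (p : ℕ) :
    aeval (0 : ℂ) (reciprocalH K i p) = 1 := by
  have hN : ∑ k ∈ Finset.Icc 1 K, i k ≠ 0 := by
    have h1 : 1 ∈ Finset.Icc 1 K := Finset.mem_Icc.2 ⟨le_rfl, hK⟩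
    have := Finset.single_le_sum (f := i) (fun _ _ => Nat.zero_le _) h1
    have := hi 1 h1
    omega
  rw [aeval_reciprocalH, zero_pow hN, mul_zero, add_zero]
  refine Finset.prod_eq_one fun k _ => ?_
  rw [Finset.sum_range_succ']
  simp

/-! ### Roots on the unit circle and Kronecker's theorem -/

theorem norm_eq_one_of_reciprocalH_root (hK : 1 ≤ K) (hi : ∀ k ∈ Finset.Icc 1 K, 0 < i k)
    {p : ℕ} (h : HasOnlyRealRoots (chebH K i p)) {w : ℂ}
    (hw : aeval w (reciprocalH K i p) = 0) : ‖w‖ = 1 := by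
  have hw0 : w ≠ 0 := by
    rintro rfl
    rw [aeval_zero_reciprocalH hK hi] at hw
    exact one_ne_zero hw
  obtain ⟨z, rfl⟩ := IsAlgClosed.exists_pow_nat_eq w (n := 2) two_pos
  have hz : z ≠ 0 := by rintro rfl; simp at hw0
  have him := h _ ((chebH_root_iff hz K i p).2 hw)
  rw [Complex.add_im, Complex.inv_im] at him
  have hn : Complex.normSq z ≠ 0 := by simpa using hz
  -- The imaginary part of z + 1/z is im z · (1 - 1/|z|²).
  have hfac : z.im * (Complex.normSq z - 1) = 0 := by
    field_simp at him
    linear_combination him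
  rcases mul_eq_zero.1 hfac with h0 | h1
  · exfalso
    have hre : z = (z.re : ℂ) := Complex.ext rfl (by simpa using h0)
    have hr : z.re ≠ 0 := by
      intro h'
      rw [h'] at hre
      exact hz (by simpa using hre)
    refine aeval_reciprocalH_ofReal_ne_zero hK hi p (s := z.re ^ 2) (by positivity) ?_
    rw [Complex.ofReal_pow, ← hre]
    exact hw
  · rw [norm_pow, Complex.sq_norm]
    linarith

/-- Kronecker's theorem in Mahler measure form: the measure of a monic polynomial is the product of
max(1, |root|), here 1. -/
theorem exists_isPrimitiveRoot_of_reciprocalH_root (hK : 1 ≤ K)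
    (hi : ∀ k ∈ Finset.Icc 1 K, 0 < i k) {p : ℕ} (h : HasOnlyRealRoots (chebH K i p)) {w : ℂ}
    (hw : aeval w (reciprocalH K i p) = 0) : ∃ n, 0 < n ∧ IsPrimitiveRoot w n := by
  have hm := monic_reciprocalH hK hi p
  refine isPrimitiveRoot_of_mahlerMeasure_eq_one (p := reciprocalH K i p) ?_ ?_ ?_
  · rw [mahlerMeasure_eq_leadingCoeff_mul_prod_roots, (hm.map _).leadingCoeff, norm_one, one_mul]
    refine Multiset.prod_eq_one fun x hx => ?_
    obtain ⟨y, hy, rfl⟩ := Multiset.mem_map.1 hx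
    have := norm_eq_one_of_reciprocalH_root hK hi h (w := y)
      (by rw [aeval_def, ← eval_map]; exact (mem_roots'.1 hy).2)
    rw [this, max_self]
  · rintro rfl
    rw [aeval_zero_reciprocalH hK hi] at hw
    exact one_ne_zero hw
  · exact mem_aroots.2 ⟨hm.ne_zero, hw⟩

end

/-! ### The sine inequality and the congruence on the indices -/

/-- |sin| has period π and is symmetric about π/2, so a may be replaced by the distance t from a to
the nearest multiple of n, with 1 ≤ t ≤ n/2. There sine is strictly increasing, so equality forces t
= 1. -/
theorem sin_pi_div_le_abs_sin {n a : ℕ} (hn : 2 ≤ n) (ha : ¬ n ∣ a) :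
    Real.sin (Real.pi / n) ≤ |Real.sin (Real.pi * a / n)| ∧
      (|Real.sin (Real.pi * a / n)| = Real.sin (Real.pi / n) → n ∣ a + 1 ∨ a % n = 1) := by
  have hn0 : (0 : ℝ) < n := by positivity
  have hpi := Real.pi_pos
  set r := a % n with hr
  have hrn : r < n := Nat.mod_lt _ (by omega)
  have hr0 : 0 < r := Nat.pos_of_ne_zero fun h => ha (Nat.dvd_of_mod_eq_zero h)
  have hdiv : (a : ℝ) = n * (a / n : ℕ) + r := by exact_mod_cast (Nat.div_add_mod a n).symm
  have e : Real.pi * a / n = Real.pi * r / n + (a / n : ℕ) * Real.pi := by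
    rw [hdiv]; field_simp; ring
  have habs : |Real.sin (Real.pi * a / n)| = Real.sin (Real.pi * r / n) := by
    rw [e, Real.sin_add_nat_mul_pi, abs_mul, abs_pow, abs_neg, abs_one, one_pow, one_mul,
      abs_of_nonneg]
    refine Real.sin_nonneg_of_nonneg_of_le_pi (by positivity) ?_
    rw [div_le_iff₀ hn0]
    gcongr
  rw [habs]
  have hcase : ∀ t : ℕ, 0 < t → 2 * t ≤ n →
      Real.sin (Real.pi / n) ≤ Real.sin (Real.pi * t / n) ∧
      (Real.sin (Real.pi * t / n) = Real.sin (Real.pi / n) → t = 1) := by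
    intro t ht htn
    have ht' : (2 : ℝ) * t ≤ n := by exact_mod_cast htn
    have h1 : (1 : ℝ) ≤ t := by exact_mod_cast ht
    have hle : Real.pi * t / n ≤ Real.pi / 2 := by
      rw [div_le_div_iff₀ hn0 two_pos]
      nlinarith
    have hpos : 0 < Real.pi / n := by positivity
    refine ⟨Real.sin_le_sin_of_le_of_le_pi_div_two (by linarith) hle ?_, fun h => ?_⟩
    · gcongr
      nlinarith
    · by_contra hne
      have h2 : (1 : ℝ) < t := by exact_mod_cast (by omega : 1 < t)
      refine (Real.sin_lt_sin_of_lt_of_le_pi_div_two (x := Real.pi / n) (by linarith) hle ?_).ne' h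
      gcongr
      nlinarith
  by_cases h2 : 2 * r ≤ n
  · exact ⟨(hcase r hr0 h2).1, fun h => Or.inr ((hcase r hr0 h2).2 h)⟩
  · have hs : Real.sin (Real.pi * r / n) = Real.sin (Real.pi * (n - r : ℕ) / n) := by
      rw [Nat.cast_sub hrn.le, ← Real.sin_pi_sub]
      congr 1
      field_simp
    rw [hs]
    have hc := hcase (n - r) (by omega) (by omega)
    refine ⟨hc.1, fun h => Or.inl ?_⟩
    have := hc.2 h
    rw [Nat.dvd_iff_mod_eq_zero, Nat.add_mod, ← hr, show r = n - 1 by omega,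
      Nat.mod_eq_of_lt (by omega : 1 < n), Nat.sub_add_cancel (by omega), Nat.mod_self]

theorem norm_exp_pow_sub_one (n a : ℕ) :
    ‖Complex.exp (2 * Real.pi * Complex.I / n) ^ a - 1‖ = 2 * |Real.sin (Real.pi * a / n)| := by
  have e : Complex.exp (2 * Real.pi * Complex.I / n) ^ a =
      Complex.exp (Complex.I * ((2 * Real.pi * a / n : ℝ) : ℂ)) := by
    rw [← Complex.exp_nat_mul]
    congr 1
    push_cast
    ring
  rw [e, Complex.norm_exp_I_mul_ofReal_sub_one, Real.norm_eq_abs, abs_mul, abs_two]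
  congr 3
  ring

theorem eq_one_of_prod_eq_one_of_one_le {ι : Type*} {s : Finset ι} {c : ι → ℝ}
    (hc : ∀ k ∈ s, 1 ≤ c k) (hprod : ∏ k ∈ s, c k = 1) : ∀ k ∈ s, c k = 1 := by
  classical
  intro k hk
  refine le_antisymm ?_ (hc k hk)
  rw [← hprod, ← Finset.mul_prod_erase s c hk]
  refine le_mul_of_one_le_right (zero_le_one.trans (hc k hk)) ?_
  calc (1 : ℝ) = ∏ _l ∈ s.erase k, 1 := by simp
    _ ≤ _ := Finset.prod_le_prod (fun _ _ => zero_le_one)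
      fun l hl => hc l (Finset.mem_of_mem_erase hl)

/-- The roots of `reciprocalH` are roots of unity; evaluating at the conjugate `exp (2πi/n)` of
smallest argument, every factor has absolute value at least `1`, hence exactly `1`. -/
theorem pow_eq_one_of_reciprocalH_root {K : ℕ} {i : ℕ → ℕ} (hK : 1 ≤ K)
    (hi : ∀ k ∈ Finset.Icc 1 K, 0 < i k) {p : ℕ} (h : HasOnlyRealRoots (chebH K i p)) {w : ℂ}
    (hw : aeval w (reciprocalH K i p) = 0) :
    ∀ k ∈ Finset.Icc 1 K, w ^ (2 * i k) = 1 ∨ w ^ (2 * i k + 2) = 1 := by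
  obtain ⟨n, hn0, hn⟩ := exists_isPrimitiveRoot_of_reciprocalH_root hK hi h hw
  have hn2 : 2 ≤ n := by
    by_contra hlt
    have h1 : n = 1 := by omega
    subst h1
    have hw1 : w = 1 := by simpa using hn.pow_eq_one
    rw [hw1] at hw
    exact aeval_reciprocalH_ofReal_ne_zero hK hi p one_pos (by simpa using hw)
  set μ := Complex.exp (2 * Real.pi * Complex.I / n) with hμ
  have hprim : IsPrimitiveRoot μ n := Complex.isPrimitiveRoot_exp n hn0.ne'
  have hroot : aeval μ (reciprocalH K i p) = 0 := by
    -- All primitive n-th roots of unity share the minimal polynomial over ℤ, so `μ` is a root as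
    -- soon as `w` is.
    have hd := minpoly.isIntegrallyClosed_dvd (hn.isIntegral hn0) hw
    rw [← cyclotomic_eq_minpoly hn hn0, cyclotomic_eq_minpoly hprim hn0] at hd
    exact aeval_eq_zero_of_dvd_aeval_eq_zero hd (minpoly.aeval ℤ μ)
  rw [aeval_reciprocalH] at hroot
  have hnorm : ∏ k ∈ Finset.Icc 1 K, ‖∑ l ∈ Finset.range (2 * i k + 1), μ ^ l‖ = 1 := by
    rw [← norm_prod, eq_neg_of_add_eq_zero_left hroot]
    simp [hprim.norm'_eq_one hn0.ne']
  have hs : 0 < Real.sin (Real.pi / n) := by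
    refine Real.sin_pos_of_pos_of_lt_pi (by positivity) (div_lt_self Real.pi_pos ?_)
    exact_mod_cast hn2
  have hfac : ∀ k, ‖∑ l ∈ Finset.range (2 * i k + 1), μ ^ l‖ * Real.sin (Real.pi / n) =
      |Real.sin (Real.pi * (2 * i k + 1 : ℕ) / n)| := by
    intro k
    have h1 := norm_exp_pow_sub_one n 1
    have h2 := norm_exp_pow_sub_one n (2 * i k + 1)
    rw [← hμ, pow_one, Nat.cast_one, mul_one, abs_of_pos hs] at h1
    rw [← hμ, ← geom_sum_mul, norm_mul, h1] at h2
    linarith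
  -- Otherwise a factor would vanish, although the product of the norms is 1.
  have hnd : ∀ k ∈ Finset.Icc 1 K, ¬ n ∣ 2 * i k + 1 := by
    intro k hk hd
    have h0 : ∑ l ∈ Finset.range (2 * i k + 1), μ ^ l = 0 := by
      have := geom_sum_mul μ (2 * i k + 1)
      rw [(hprim.pow_eq_one_iff_dvd _).2 hd, sub_self] at this
      exact (mul_eq_zero.1 this).resolve_right (sub_ne_zero.2 (hprim.ne_one (by omega)))
    rw [Finset.prod_eq_zero hk (by rw [h0, norm_zero])] at hnorm
    exact zero_ne_one hnorm
  have hone := eq_one_of_prod_eq_one_of_one_le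
    (fun k hk => le_of_mul_le_mul_right
      (by rw [one_mul, hfac]; exact (sin_pi_div_le_abs_sin hn2 (hnd k hk)).1) hs) hnorm
  intro k hk
  have := hfac k
  rw [hone k hk, one_mul] at this
  rw [hn.pow_eq_one_iff_dvd, hn.pow_eq_one_iff_dvd]
  rcases (sin_pi_div_le_abs_sin hn2 (hnd k hk)).2 this.symm with h' | h'
  · exact Or.inr h'
  · left
    have := Nat.div_add_mod (2 * i k + 1) n
    rw [h'] at this
    exact ⟨(2 * i k + 1) / n, by omega⟩

/-! ### Angles of the roots -/

theorem sin_eq_zero_of_exp_pow_eq_one {θ : ℝ} {n : ℕ}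
    (h : (Complex.exp (θ * Complex.I) ^ 2) ^ n = 1) : Real.sin (n * θ) = 0 := by
  have e : (Complex.exp (θ * Complex.I) ^ 2) ^ n =
      Complex.exp (Complex.I * ((2 * (n * θ) : ℝ) : ℂ)) := by
    rw [← pow_mul, ← Complex.exp_nat_mul]
    congr 1
    push_cast
    ring
  have h2 := Complex.norm_exp_I_mul_ofReal_sub_one (2 * (n * θ))
  rw [← e, h, sub_self, norm_zero, mul_div_cancel_left₀ _ (two_ne_zero' ℝ)] at h2
  simpa using h2.symm

/-- When `chebH` has only real roots, these are numbers `2 cos θ` where `(2 i_k + 1) θ ≡ ± θ`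
modulo `π` for every `k`. -/
theorem exists_angle_of_root {K : ℕ} {i : ℕ → ℕ} (hK : 1 ≤ K)
    (hi : ∀ k ∈ Finset.Icc 1 K, 0 < i k) {p : ℕ} (h : HasOnlyRealRoots (chebH K i p)) {y : ℝ}
    (hy : (chebH K i p).eval y = 0) :
    ∃ θ ∈ Set.Ioo 0 Real.pi, y = 2 * Real.cos θ ∧ ∀ k ∈ Finset.Icc 1 K,
      Real.sin (2 * i k * θ) = 0 ∨ Real.sin ((2 * i k + 2) * θ) = 0 := by
  have hyC : aeval (y : ℂ) (chebH K i p) = 0 := by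
    have := aeval_algebraMap_apply ℂ y (chebH K i p)
    rw [Complex.coe_algebraMap] at this
    rw [this, coe_aeval_eq_eval, hy, Complex.ofReal_zero]
  have hlt : y ^ 2 < 4 := by
    by_contra hge
    push Not at hge
    -- If |y| ≥ 2, then y = r + 1/r has a real solution r, and r² would be a positive root of the
    -- reciprocal polynomial.
    set r := (y + Real.sqrt (y ^ 2 - 4)) / 2 with hr
    have hsq : Real.sqrt (y ^ 2 - 4) ^ 2 = y ^ 2 - 4 := Real.sq_sqrt (by linarith)
    have hquad : r * (y - r) = 1 := by rw [hr]; linear_combination -hsq / 4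
    have hr0 : r ≠ 0 := left_ne_zero_of_mul_eq_one hquad
    have hyr : (y : ℂ) = (r : ℂ) + (r : ℂ)⁻¹ := by
      rw [← Complex.ofReal_inv, ← Complex.ofReal_add, inv_eq_of_mul_eq_one_right hquad]
      simp
    rw [hyr, chebH_root_iff (by exact_mod_cast hr0), ← Complex.ofReal_pow] at hyC
    exact aeval_reciprocalH_ofReal_ne_zero hK hi p (by positivity) hyC
  have hb := abs_lt_of_sq_lt_sq (by linarith : y ^ 2 < 2 ^ 2) two_pos.le
  rw [abs_lt] at hb
  have hcos : Real.cos (Real.arccos (y / 2)) = y / 2 :=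
    Real.cos_arccos (by linarith) (by linarith)
  refine ⟨Real.arccos (y / 2), ⟨Real.arccos_pos.2 (by linarith), ?_⟩, by rw [hcos]; ring, ?_⟩
  · refine lt_of_le_of_ne (Real.arccos_le_pi _) fun h' => ?_
    rw [h', Real.cos_pi] at hcos
    linarith
  set θ := Real.arccos (y / 2) with hθ
  have hyz : (y : ℂ) = Complex.exp (θ * Complex.I) + (Complex.exp (θ * Complex.I))⁻¹ := by
    rw [← Complex.exp_neg, ← neg_mul, ← Complex.two_cos, ← Complex.ofReal_cos, hcos]
    push_cast
    ring
  rw [hyz, chebH_root_iff (Complex.exp_ne_zero _)] at hyC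
  intro k hk
  refine (pow_eq_one_of_reciprocalH_root hK hi h hyC k hk).imp (fun h' => ?_) fun h' => ?_
  · simpa using sin_eq_zero_of_exp_pow_eq_one h'
  · simpa using sin_eq_zero_of_exp_pow_eq_one h'

/-! ### Real-rooted polynomials near their largest roots -/

theorem HasOnlyRealRoots.splits {f : ℝ[X]} (h : HasOnlyRealRoots f) : f.Splits := by
  refine Splits.of_splits_map (algebraMap ℝ ℂ) (IsAlgClosed.splits _) fun z hz => ?_
  have := h z (by rw [aeval_def, ← eval_map]; exact (mem_roots'.1 hz).2)
  exact ⟨z.re, Complex.ext rfl (by simp [this])⟩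

theorem eval_prod_X_sub_C_nonneg {s : Multiset ℝ} {x : ℝ} (h : ∀ r ∈ s, r ≤ x) :
    0 ≤ ((s.map fun r => X - C r).prod).eval x := by
  induction s using Multiset.induction_on with
  | empty => simp
  | cons r s ih =>
    rw [Multiset.map_cons, Multiset.prod_cons, eval_mul, eval_sub, eval_X, eval_C]
    exact mul_nonneg (sub_nonneg.2 (h r (Multiset.mem_cons_self r s)))
      (ih fun t ht => h t (Multiset.mem_cons_of_mem ht))

theorem eval_derivative_prod_X_sub_C_pos {s : Multiset ℝ} {x : ℝ} (h : ∀ r ∈ s, r < x) :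
    0 < ((s.map fun r => X - C r).prod).eval x ∧
      (s ≠ 0 → 0 < (derivative (s.map fun r => X - C r).prod).eval x) := by
  induction s using Multiset.induction_on with
  | empty => simp
  | cons r s ih =>
    have ih := ih fun t ht => h t (Multiset.mem_cons_of_mem ht)
    have hr : 0 < x - r := sub_pos.2 (h r (Multiset.mem_cons_self r s))
    rw [Multiset.map_cons, Multiset.prod_cons]
    refine ⟨by simpa using mul_pos hr ih.1, fun _ => ?_⟩
    rw [derivative_mul, derivative_X_sub_C, one_mul, eval_add, eval_mul, eval_sub, eval_X, eval_C]
    by_cases hs : s = 0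
    · simp [hs]
    · exact add_pos ih.1 (mul_pos hr (ih.2 hs))

theorem Multiset.exists_eq_cons_max {s : Multiset ℝ} (hs : s ≠ 0) :
    ∃ y t, s = y ::ₘ t ∧ ∀ r ∈ t, r ≤ y := by
  have hne : s.toFinset.Nonempty := by
    obtain ⟨a, ha⟩ := Multiset.exists_mem_of_ne_zero hs
    exact ⟨a, Multiset.mem_toFinset.2 ha⟩
  obtain ⟨t, ht⟩ := Multiset.exists_cons_of_mem
    (Multiset.mem_toFinset.1 (s.toFinset.max'_mem hne))
  refine ⟨_, t, ht, fun r hr => s.toFinset.le_max' _ (Multiset.mem_toFinset.2 ?_)⟩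
  rw [ht]
  exact Multiset.mem_cons_of_mem hr

/-- The two largest roots of a monic real-rooted polynomial. -/
theorem exists_two_largest_roots {f : ℝ[X]} (hf : f.Splits) (hm : f.Monic)
    (hd : 2 ≤ f.natDegree) :
    ∃ y₁ y₂, y₂ ≤ y₁ ∧ f.eval y₁ = 0 ∧ f.eval y₂ = 0 ∧
      (∀ x, y₁ < x → 0 < (derivative f).eval x) ∧
      (∀ x, y₂ ≤ x → x ≤ y₁ → f.eval x ≤ 0) ∧
      (y₁ = y₂ → (derivative f).eval y₁ = 0) := by
  have hprod := hf.eq_prod_roots_of_monic hm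
  rw [hf.natDegree_eq_card_roots] at hd
  obtain ⟨y₁, t, ht, hy₁⟩ := Multiset.exists_eq_cons_max (s := f.roots)
    (by rintro h; rw [h] at hd; simp at hd)
  obtain ⟨y₂, u, hu, hy₂⟩ := Multiset.exists_eq_cons_max (s := t)
    (by rintro h; rw [ht, h] at hd; simp at hd)
  have h21 : y₂ ≤ y₁ := hy₁ y₂ (by rw [hu]; exact Multiset.mem_cons_self _ _)
  have hfac : f = (X - C y₁) * ((X - C y₂) * (u.map fun r => X - C r).prod) := by
    conv_lhs => rw [hprod, ht, hu]
    simp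
  refine ⟨y₁, y₂, h21, by rw [hfac]; simp, by rw [hfac]; simp, fun x hx => ?_, fun x h2 h1 => ?_,
    fun h => ?_⟩
  · rw [hprod]
    refine (eval_derivative_prod_X_sub_C_pos fun r hr => ?_).2 (by rw [ht]; simp)
    rw [ht, Multiset.mem_cons] at hr
    rcases hr with rfl | hr
    · exact hx
    · exact (hy₁ r hr).trans_lt hx
  · rw [hfac, eval_mul, eval_mul]
    refine mul_nonpos_of_nonpos_of_nonneg (by simpa using h1) (mul_nonneg (by simpa using h2) ?_)
    exact eval_prod_X_sub_C_nonneg fun r hr => (hy₂ r hr).trans h2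
  · rw [hfac, ← h]
    simp

/-! ### Values and derivatives of P_n at 2 cos θ -/

theorem chebP_eval_two_mul_cos (n : ℕ) (θ : ℝ) :
    (chebP n).eval (2 * Real.cos θ) * Real.sin θ = Real.sin ((n + 1) * θ) := by
  simp [chebP]

theorem chebP_eval_pos {n : ℕ} {θ : ℝ} (h0 : 0 < θ) (h : (n + 1) * θ < Real.pi) :
    0 < (chebP n).eval (2 * Real.cos θ) := by
  have hn : (0 : ℝ) ≤ n := n.cast_nonneg
  have hs : 0 < Real.sin θ := Real.sin_pos_of_pos_of_lt_pi h0 (by nlinarith)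
  refine pos_of_mul_pos_left ?_ hs.le
  rw [chebP_eval_two_mul_cos]
  exact Real.sin_pos_of_pos_of_lt_pi (by positivity) h

theorem chebP_eval_eq_zero {n l : ℕ} (hl : 0 < l) (hln : l < n + 1) :
    (chebP n).eval (2 * Real.cos (l * Real.pi / (n + 1))) = 0 := by
  have hpi := Real.pi_pos
  have hs : 0 < Real.sin (l * Real.pi / (n + 1)) := by
    refine Real.sin_pos_of_pos_of_lt_pi (by positivity) ?_
    rw [div_lt_iff₀ (by positivity), mul_comm]
    have : (l : ℝ) < n + 1 := by exact_mod_cast hln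
    gcongr
  refine (mul_eq_zero.1 ?_).resolve_right hs.ne'
  rw [chebP_eval_two_mul_cos, mul_div_cancel₀ _ (by positivity), Real.sin_nat_mul_pi]

theorem chebP_derivative_eval (n : ℕ) (θ : ℝ) :
    2 * Real.sin θ ^ 2 * (derivative (chebP n)).eval (2 * Real.cos θ) =
      Real.cos θ * (chebP n).eval (2 * Real.cos θ) - (n + 1) * Real.cos ((n + 1) * θ) := by
  have h1 : HasDerivAt (fun t => (chebP n).eval (2 * Real.cos t) * Real.sin t)
      ((derivative (chebP n)).eval (2 * Real.cos θ) * (2 * -Real.sin θ) * Real.sin θ +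
        (chebP n).eval (2 * Real.cos θ) * Real.cos θ) θ :=
    (((chebP n).hasDerivAt _).comp θ ((Real.hasDerivAt_cos θ).const_mul 2)).mul
      (Real.hasDerivAt_sin θ)
  have h2 : HasDerivAt (fun t => Real.sin ((n + 1) * t))
      (Real.cos ((n + 1) * θ) * ((n + 1) * 1)) θ :=
    ((hasDerivAt_id θ).const_mul ((n : ℝ) + 1)).sin
  rw [show (fun t => (chebP n).eval (2 * Real.cos t) * Real.sin t) =
    fun t => Real.sin ((n + 1) * t) from funext fun t => chebP_eval_two_mul_cos n t] at h1
  linear_combination -(h1.unique h2)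

/-- Value and derivative of `chebP n` at a point where `(n + 1) θ ≡ θ` modulo `π`. -/
theorem chebP_of_sin_eq_zero {n : ℕ} {θ : ℝ} (hs : Real.sin θ ≠ 0) (h : Real.sin (n * θ) = 0) :
    (chebP n).eval (2 * Real.cos θ) = Real.cos (n * θ) ∧
    2 * Real.sin θ ^ 2 * (derivative (chebP n)).eval (2 * Real.cos θ) =
      -(n * Real.cos (n * θ) * Real.cos θ) := by
  have e : (n + 1) * θ = n * θ + θ := by ring
  have hv : (chebP n).eval (2 * Real.cos θ) = Real.cos (n * θ) := by
    have := chebP_eval_two_mul_cos n θ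
    rw [e, Real.sin_add, h, zero_mul, zero_add] at this
    exact mul_right_cancel₀ hs this
  refine ⟨hv, ?_⟩
  rw [chebP_derivative_eval, hv, e, Real.cos_add, h]
  ring

/-- Value and derivative of `chebP n` at a point where `(n + 1) θ ≡ -θ` modulo `π`. -/
theorem chebP_of_sin_add_two_eq_zero {n : ℕ} {θ : ℝ} (hs : Real.sin θ ≠ 0)
    (h : Real.sin ((n + 2) * θ) = 0) :
    (chebP n).eval (2 * Real.cos θ) = -Real.cos ((n + 2) * θ) ∧
    2 * Real.sin θ ^ 2 * (derivative (chebP n)).eval (2 * Real.cos θ) =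
      -((n + 2) * Real.cos ((n + 2) * θ) * Real.cos θ) := by
  have e : (n + 1) * θ = (n + 2) * θ - θ := by ring
  have hv : (chebP n).eval (2 * Real.cos θ) = -Real.cos ((n + 2) * θ) := by
    have := chebP_eval_two_mul_cos n θ
    rw [e, Real.sin_sub, h, zero_mul, zero_sub, ← neg_mul] at this
    exact mul_right_cancel₀ hs this
  refine ⟨hv, ?_⟩
  rw [chebP_derivative_eval, hv, e, Real.cos_sub, h]
  ring

theorem monic_chebH {K : ℕ} {i : ℕ → ℕ} (hK : 1 ≤ K) (hi : ∀ k ∈ Finset.Icc 1 K, 0 < i k)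
    (p : ℕ) : (chebH K i p).Monic ∧
      (chebH K i p).natDegree = ∑ k ∈ Finset.Icc 1 K, 2 * i k := by
  have hm : (∏ k ∈ Finset.Icc 1 K, chebP (2 * i k)).Monic :=
    monic_prod_of_monic _ _ fun k _ => chebP_monic _
  have hd : (∏ k ∈ Finset.Icc 1 K, chebP (2 * i k)).natDegree =
      ∑ k ∈ Finset.Icc 1 K, 2 * i k := by
    rw [natDegree_prod_of_monic _ _ fun k _ => chebP_monic _]
    simp [chebP_natDegree]
  have h1 : 1 ∈ Finset.Icc 1 K := Finset.mem_Icc.2 ⟨le_rfl, hK⟩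
  have hpos : 0 < ∑ k ∈ Finset.Icc 1 K, 2 * i k := by
    refine Finset.sum_pos (fun k hk => ?_) ⟨1, h1⟩
    have := hi k hk
    omega
  have e : ((-1) ^ p : ℝ[X]) = C ((-1) ^ p) := by simp
  have hlt : ((-1) ^ p : ℝ[X]).degree < (∏ k ∈ Finset.Icc 1 K, chebP (2 * i k)).degree := by
    rw [degree_eq_natDegree hm.ne_zero, hd, e]
    exact degree_C_le.trans_lt (by exact_mod_cast hpos)
  refine ⟨hm.add_of_left hlt, ?_⟩
  rw [chebH, natDegree_add_eq_left_of_degree_lt hlt, hd]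

theorem two_mul_cos_lt_iff {a b : ℝ} (ha : 0 ≤ a) (ha' : a ≤ Real.pi) (hb : 0 ≤ b)
    (hb' : b ≤ Real.pi) : 2 * Real.cos a < 2 * Real.cos b ↔ b < a := by
  rw [mul_lt_mul_iff_right₀ two_pos]
  exact Real.strictAntiOn_cos.lt_iff_gt ⟨ha, ha'⟩ ⟨hb, hb'⟩

/-- Here 2mθ lies strictly between 0 and π, which excludes the first alternative, and (2m+2)θ lies
strictly between 0 and 2π. -/
theorem angle_eq_of_pos {m : ℕ} (hm : 0 < m) {θ : ℝ} (h0 : 0 < θ)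
    (h : (2 * m + 1) * θ < Real.pi)
    (hs : Real.sin (2 * m * θ) = 0 ∨ Real.sin ((2 * m + 2) * θ) = 0) :
    (2 * m + 2) * θ = Real.pi := by
  have hm' : (1 : ℝ) ≤ m := by exact_mod_cast hm
  have hlt : θ < Real.pi := by nlinarith
  rcases hs with hs | hs
  · exact absurd hs (Real.sin_pos_of_pos_of_lt_pi (by positivity) (by nlinarith)).ne'
  · have h2 : Real.sin ((2 * m + 2) * θ - Real.pi) = 0 := by rw [Real.sin_sub_pi, hs, neg_zero]
    rw [Real.sin_eq_zero_iff_of_lt_of_lt (by nlinarith) (by nlinarith)] at h2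
    linarith

/-! ### Necessity for p = 1 -/

theorem indices_eq_of_hasOnlyRealRoots_one {K : ℕ} {i : ℕ → ℕ} (hK : 1 ≤ K)
    (hi : ∀ k ∈ Finset.Icc 1 K, 0 < i k) (h : HasOnlyRealRoots (chebH K i 1)) :
    ∀ k ∈ Finset.Icc 1 K, ∀ l ∈ Finset.Icc 1 K, i k = i l := by
  have hpi := Real.pi_pos
  obtain ⟨k₀, hk₀, hmax⟩ := Finset.exists_max_image (Finset.Icc 1 K) i
    ⟨1, Finset.mem_Icc.2 ⟨le_rfl, hK⟩⟩
  set M := i k₀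
  have hM : 0 < M := hi k₀ hk₀
  -- The largest index gives the largest zero 2 cos α among all factors. As h is -1 there and
  -- positive at 2, it has a root beyond every zero of the factors.
  set α : ℝ := Real.pi / (2 * M + 1) with hα
  have hα0 : 0 < α := by positivity
  have hαM : (2 * M + 1) * α = Real.pi := mul_div_cancel₀ _ (by positivity)
  set g : ℝ → ℝ := fun t => (chebH K i 1).eval (2 * Real.cos t) with hg
  have hgc : Continuous g := (chebH K i 1).continuous.comp (by fun_prop)
  have hα1 : g α = -1 := by
    have h0 : (chebP (2 * M)).eval (2 * Real.cos α) = 0 := by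
      have := chebP_eval_eq_zero (n := 2 * M) (l := 1) one_pos (by omega)
      simpa [hα] using this
    simp only [hg, chebH, eval_add, eval_prod, pow_one, eval_neg, eval_one]
    rw [Finset.prod_eq_zero hk₀ h0, zero_add]
  have hg0 : 0 < g 0 := by
    have hv : ∀ k, (chebP (2 * i k)).eval 2 = 2 * (i k : ℝ) + 1 := by
      intro k
      rw [chebP, Chebyshev.S_eval_two]
      push_cast
      ring
    have : (1 : ℝ) < ∏ k ∈ Finset.Icc 1 K, (2 * (i k : ℝ) + 1) := by
      calc (1 : ℝ) = ∏ _k ∈ Finset.Icc 1 K, 1 := by simp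
        _ < _ := Finset.prod_lt_prod_of_nonempty (fun _ _ => one_pos) (fun k hk => ?_) ⟨k₀, hk₀⟩
      have : (0 : ℝ) < i k := by exact_mod_cast hi k hk
      linarith
    simp only [hg, Real.cos_zero, mul_one, chebH, eval_add, eval_prod, pow_one, eval_neg, eval_one,
      hv]
    linarith
  obtain ⟨φ, ⟨hφ0, hφα⟩, hφ⟩ := intermediate_value_Ioo' hα0.le hgc.continuousOn
    (show (0 : ℝ) ∈ Set.Ioo (g α) (g 0) from ⟨by rw [hα1]; norm_num, hg0⟩)
  have hαpi : α < Real.pi := div_lt_self hpi (by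
    have : (0 : ℝ) < M := by exact_mod_cast hM
    linarith)
  obtain ⟨θ, ⟨hθ0, hθpi⟩, hθ, hθs⟩ := exists_angle_of_root hK hi h hφ
  have hθφ : φ = θ := Real.injOn_cos ⟨hφ0.le, (hφα.trans hαpi).le⟩ ⟨hθ0.le, hθpi.le⟩
    (by linarith)
  subst hθφ
  have key : ∀ k ∈ Finset.Icc 1 K, (2 * (i k : ℝ) + 2) * φ = Real.pi := by
    intro k hk
    refine angle_eq_of_pos (hi k hk) hφ0 ?_ (hθs k hk)
    have : (i k : ℝ) ≤ M := by exact_mod_cast hmax k hk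
    nlinarith
  intro k hk l hl
  have := mul_right_cancel₀ hφ0.ne' ((key k hk).trans (key l hl).symm)
  have h' : (i k : ℝ) = i l := by linarith
  exact_mod_cast h'

theorem exists_complex_root {f : ℝ[X]} (hf : 0 < f.natDegree) : ∃ z : ℂ, aeval z f = 0 :=
  IsAlgClosed.exists_aeval_eq_zero ℂ f (natDegree_pos_iff_degree_pos.1 hf).ne'

theorem card_le_two_of_hasOnlyRealRoots_one {K : ℕ} {i : ℕ → ℕ} (hK : 1 ≤ K)
    (hi : ∀ k ∈ Finset.Icc 1 K, 0 < i k) (h : HasOnlyRealRoots (chebH K i 1)) : K ≤ 2 := by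
  have h1 : 1 ∈ Finset.Icc 1 K := Finset.mem_Icc.2 ⟨le_rfl, hK⟩
  set S := chebP (2 * i 1) with hS
  have hdS : 0 < S.natDegree := by
    have := hi 1 h1
    rw [hS, chebP_natDegree]
    omega
  have hH : chebH K i 1 = S ^ K - 1 := by
    rw [chebH, Finset.prod_congr rfl fun k hk => by
      rw [indices_eq_of_hasOnlyRealRoots_one hK hi h k hk 1 h1, ← hS], Finset.prod_const, Nat.card_Icc, Nat.add_sub_cancel]
    simp [S, sub_eq_add_neg]
  by_contra hlt
  push Not at hlt
  -- S^K - 1 is divisible by a geometric sum: in S² if K is even, in S (with an odd number of terms)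
  -- if K is odd. Both are positive on ℝ.
  have hfact : ∃ L : ℕ, 0 < L ∧ ∃ T : ℝ[X], 0 < T.natDegree ∧ T.Monic ∧
      (∑ l ∈ Finset.range (L + 1), T ^ l) ∣ chebH K i 1 ∧
      ∀ x : ℝ, (∑ l ∈ Finset.range (L + 1), T ^ l).eval x ≠ 0 := by
    rcases Nat.even_or_odd' K with ⟨L, hL | hL⟩
    · refine ⟨L - 1, by omega, S ^ 2, by rw [natDegree_pow]; omega, (chebP_monic _).pow 2, ?_, ?_⟩
      · rw [hH, hL, pow_mul, Nat.sub_add_cancel (by omega), ← geom_sum_mul]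
        exact dvd_mul_right _ _
      · intro x
        rw [eval_finsetSum]
        simp only [eval_pow]
        refine (geom_sum_pos (by positivity) (by omega)).ne'
    · refine ⟨2 * L, by omega, S, hdS, chebP_monic _, ?_, ?_⟩
      · rw [hH, hL, ← geom_sum_mul]
        exact dvd_mul_right _ _
      · intro x
        rw [eval_finsetSum]
        simp only [eval_pow]
        exact (Odd.geom_sum_pos ⟨L, rfl⟩).ne'
  obtain ⟨L, hL, T, hT, hTm, hdvd, hne⟩ := hfact
  have hdeg : 0 < (∑ l ∈ Finset.range (L + 1), T ^ l).natDegree := by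
    have := hTm.geom_sum hT L.succ_ne_zero
    have hmul := geom_sum_mul T (L + 1)
    by_contra h0
    have h00 : (∑ l ∈ Finset.range (L + 1), T ^ l).natDegree = 0 := by omega
    have h1' : ∑ l ∈ Finset.range (L + 1), T ^ l = 1 := this.natDegree_eq_zero.1 h00
    rw [h1', one_mul, sub_left_inj] at hmul
    have := congrArg natDegree hmul
    rw [natDegree_pow] at this
    nlinarith
  obtain ⟨z, hz⟩ := exists_complex_root hdeg
  have hzim := h z (aeval_eq_zero_of_dvd_aeval_eq_zero hdvd hz)
  have hzr : z = algebraMap ℝ ℂ z.re := Complex.ext rfl (by simp [hzim])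
  rw [hzr, aeval_algebraMap_apply] at hz
  rw [coe_aeval_eq_eval, map_eq_zero] at hz
  exact hne z.re hz

/-! ### Necessity for p = 0 -/

theorem indices_of_hasOnlyRealRoots_zero {K : ℕ} {i : ℕ → ℕ} (hK : 2 ≤ K)
    (hi : ∀ k ∈ Finset.Icc 1 K, 0 < i k) (h : HasOnlyRealRoots (chebH K i 0)) :
    K = 2 ∧ |(i 1 : ℤ) - (i 2 : ℤ)| = 1 := by
  have hpi := Real.pi_pos
  have hK1 : 1 ≤ K := by omega
  have h1 : 1 ∈ Finset.Icc 1 K := Finset.mem_Icc.2 ⟨le_rfl, hK1⟩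
  have h2 : 2 ∈ Finset.Icc 1 K := Finset.mem_Icc.2 ⟨one_le_two, hK⟩
  set f := ∏ k ∈ Finset.Icc 1 K, chebP (2 * i k) with hf
  have hH : chebH K i 0 = f + 1 := by rw [chebH, pow_zero]
  have hHe : ∀ x, (chebH K i 0).eval x = f.eval x + 1 := fun x => by simp [hH]
  have hHd : derivative (chebH K i 0) = derivative f := by simp [hH]
  have hf0 : ∀ k ∈ Finset.Icc 1 K, ∀ x, (chebP (2 * i k)).eval x = 0 → f.eval x = 0 :=
    fun k hk x hx => by rw [hf, eval_prod, Finset.prod_eq_zero hk hx]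
  have hmon := monic_chebH hK1 hi 0
  obtain ⟨y₁, y₂, h21, hy₁, hy₂, hder, hnonpos, hdouble⟩ :=
    exists_two_largest_roots h.splits hmon.1 (by
      rw [hmon.2]
      have := Finset.single_le_sum (f := fun k => 2 * i k) (fun _ _ => Nat.zero_le _) h1
      have := hi 1 h1
      omega)
  rw [hHd] at hder hdouble
  -- above `y₁` there is at most one root of `f`, and it is a root of a single factor
  have huniq : ∀ s s', y₁ < s → s < s' → f.eval s = 0 → f.eval s' = 0 → False := by
    intro s s' hs hss h0 h0'
    obtain ⟨c, hc, hc'⟩ := exists_deriv_eq_zero hss f.continuous.continuousOn (h0.trans h0'.symm)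
    rw [Polynomial.deriv] at hc'
    exact (hder c (hs.trans hc.1)).ne' hc'
  have huniq' : ∀ k ∈ Finset.Icc 1 K, ∀ l ∈ Finset.Icc 1 K, ∀ s s', y₁ < s → y₁ < s' →
      (chebP (2 * i k)).eval s = 0 → (chebP (2 * i l)).eval s' = 0 → k = l ∧ s = s' := by
    intro k hk l hl s s' hs hs' h0 h0'
    have hss : s = s' := by
      rcases lt_trichotomy s s' with hlt | heq | hlt
      · exact (huniq s s' hs hlt (hf0 k hk s h0) (hf0 l hl s' h0')).elim
      · exact heq
      · exact (huniq s' s hs' hlt (hf0 l hl s' h0') (hf0 k hk s h0)).elim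
    refine ⟨?_, hss⟩
    by_contra hkl
    subst hss
    have hl' : l ∈ (Finset.Icc 1 K).erase k := Finset.mem_erase.2 ⟨fun e => hkl e.symm, hl⟩
    have hfac : f = chebP (2 * i k) * (chebP (2 * i l) *
        ∏ m ∈ ((Finset.Icc 1 K).erase k).erase l, chebP (2 * i m)) := by
      rw [Finset.mul_prod_erase _ (fun m => chebP (2 * i m)) hl',
        Finset.mul_prod_erase _ (fun m => chebP (2 * i m)) hk]
    refine (hder s hs).ne' ?_
    rw [hfac]
    simp [h0, h0']
  obtain ⟨φ₁, ⟨hφ₁0, hφ₁π⟩, hφ₁, hs₁⟩ := exists_angle_of_root hK1 hi h hy₁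
  obtain ⟨φ₂, ⟨hφ₂0, hφ₂π⟩, hφ₂, hs₂⟩ := exists_angle_of_root hK1 hi h hy₂
  have hφ12 : φ₁ ≤ φ₂ := by
    by_contra hlt
    push Not at hlt
    rw [← two_mul_cos_lt_iff hφ₁0.le hφ₁π.le hφ₂0.le hφ₂π.le, ← hφ₁, ← hφ₂] at hlt
    linarith
  -- the largest root of the factor with index `k`
  set α : ℕ → ℝ := fun k => Real.pi / (2 * i k + 1) with hα
  have hα0 : ∀ k, 0 < α k := fun k => by positivity
  have hαe : ∀ k, (2 * (i k : ℝ) + 1) * α k = Real.pi :=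
    fun k => mul_div_cancel₀ _ (by positivity)
  have hαπ : ∀ k ∈ Finset.Icc 1 K, α k < Real.pi := fun k hk => div_lt_self hpi (by
    have : (0 : ℝ) < i k := by exact_mod_cast hi k hk
    linarith)
  have hαr : ∀ k ∈ Finset.Icc 1 K, (chebP (2 * i k)).eval (2 * Real.cos (α k)) = 0 := by
    intro k hk
    have := hi k hk
    have := chebP_eval_eq_zero (n := 2 * i k) (l := 1) one_pos (by omega)
    simpa [hα] using this
  -- On [y₂, y₁] one has f ≤ -1, so a zero of f that is not above y₁ lies below y₂.
  have hsmall : ∀ k ∈ Finset.Icc 1 K, ¬ y₁ < 2 * Real.cos (α k) → φ₂ < α k := by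
    intro k hk hle
    push Not at hle
    rw [← two_mul_cos_lt_iff (hα0 k).le (hαπ k hk).le hφ₂0.le hφ₂π.le, ← hφ₂]
    by_contra hge
    push Not at hge
    have := hnonpos _ hge hle
    rw [hHe, hf0 k hk _ (hαr k hk)] at this
    linarith
  -- Otherwise every factor would be positive at y₁, where f = -1.
  obtain ⟨k₀, hk₀, hk₀y⟩ : ∃ k ∈ Finset.Icc 1 K, y₁ < 2 * Real.cos (α k) := by
    by_contra hno
    push Not at hno
    have : 0 < f.eval y₁ := by
      rw [hf, eval_prod]
      refine Finset.prod_pos fun k hk => ?_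
      rw [hφ₁]
      refine chebP_eval_pos hφ₁0 ?_
      have := hsmall k hk (not_lt.2 (hno k hk))
      rw [← hαe k]
      push_cast
      have : φ₁ < α k := by linarith
      gcongr
    rw [hHe] at hy₁
    linarith
  have hother : ∀ l ∈ Finset.Icc 1 K, l ≠ k₀ →
      (2 * i l + 2) * φ₁ = Real.pi ∧ (2 * i l + 2) * φ₂ = Real.pi := by
    intro l hl hlk
    have hlt := hsmall l hl fun hlt =>
      hlk (huniq' l hl k₀ hk₀ _ _ hlt hk₀y (hαr l hl) (hαr k₀ hk₀)).1
    have e2 : (2 * (i l : ℝ) + 1) * φ₂ < Real.pi := by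
      rw [← hαe l]
      gcongr
    have e1 : (2 * (i l : ℝ) + 1) * φ₁ < Real.pi :=
      lt_of_le_of_lt (by gcongr) e2
    exact ⟨angle_eq_of_pos (hi l hl) hφ₁0 e1 (hs₁ l hl),
      angle_eq_of_pos (hi l hl) hφ₂0 e2 (hs₂ l hl)⟩
  obtain ⟨l₀, hl₀, hlk₀⟩ : ∃ l ∈ Finset.Icc 1 K, l ≠ k₀ := by
    by_cases hk : k₀ = 1
    · exact ⟨2, h2, by omega⟩
    · exact ⟨1, h1, fun e => hk e.symm⟩
  obtain ⟨ho₁, ho₂⟩ := hother l₀ hl₀ hlk₀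
  set m := i l₀ with hm
  set M := i k₀ with hM
  have hm0 : 0 < m := hi l₀ hl₀
  -- Both angles equal π/(2m+2), so the top root is double and the derivative vanishes there.
  have hφφ : φ₁ = φ₂ := mul_left_cancel₀ (by positivity) (ho₁.trans ho₂.symm)
  have hd0 := hdouble (by rw [hφ₁, hφ₂, hφφ])
  have him : ∀ l ∈ (Finset.Icc 1 K).erase k₀, i l = m := by
    intro l hl
    rw [Finset.mem_erase] at hl
    have := mul_right_cancel₀ hφ₁0.ne' ((hother l hl.2 hl.1).1.trans ho₁.symm)
    have h' : (i l : ℝ) = m := by linarith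
    exact_mod_cast h'
  have hfac : f = chebP (2 * M) * chebP (2 * m) ^ (K - 1) := by
    rw [hf, ← Finset.mul_prod_erase _ (fun l => chebP (2 * i l)) hk₀,
      Finset.prod_congr rfl fun l hl => by rw [him l hl], Finset.prod_const,
      Finset.card_erase_of_mem hk₀, Nat.card_Icc, Nat.add_sub_cancel]
  have hsin : 0 < Real.sin φ₁ := Real.sin_pos_of_pos_of_lt_pi hφ₁0 hφ₁π
  have hmR : (1 : ℝ) ≤ m := by exact_mod_cast hm0
  have hcos : 0 < Real.cos φ₁ := Real.cos_pos_of_mem_Ioo ⟨by linarith, by nlinarith⟩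
  obtain ⟨hvm, hdm⟩ := chebP_of_sin_add_two_eq_zero (n := 2 * m) hsin.ne'
    (by push_cast; rw [ho₁, Real.sin_pi])
  push_cast at hvm hdm
  rw [ho₁, Real.cos_pi, neg_neg] at hvm
  rw [ho₁, Real.cos_pi] at hdm
  rw [← hφ₁] at hvm hdm
  have hvM : (chebP (2 * M)).eval y₁ = -1 := by
    rw [hHe, hfac, eval_mul, eval_pow, hvm, one_pow, mul_one] at hy₁
    linarith
  have hdM : (derivative (chebP (2 * M))).eval y₁ =
      (K - 1 : ℕ) * (derivative (chebP (2 * m))).eval y₁ := by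
    rw [hfac, derivative_mul, derivative_pow] at hd0
    simp only [eval_add, eval_mul, eval_pow, hvm, hvM, one_pow, eval_C] at hd0
    linarith
  -- `hdM` compares the two derivatives. The alternative sin((2M+2)φ₁) = 0 would give them opposite
  -- signs.
  have hKm : (M : ℝ) = (K - 1 : ℕ) * (m + 1) := by
    rcases hs₁ k₀ hk₀ with hs | hs
    · obtain ⟨hv, hd⟩ := chebP_of_sin_eq_zero (n := 2 * M) hsin.ne' (by push_cast; exact hs)
      rw [← hφ₁] at hv hd
      rw [← hv, hvM, hdM] at hd
      push_cast at hd
      refine mul_right_cancel₀ (mul_pos two_pos hcos).ne' ?_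
      linear_combination -hd + ((K - 1 : ℕ) : ℝ) * hdm
    · exfalso
      obtain ⟨hv, hd⟩ := chebP_of_sin_add_two_eq_zero (n := 2 * M) hsin.ne'
        (by push_cast; exact hs)
      rw [← hφ₁] at hv hd
      have hc : Real.cos (((2 * M : ℕ) + 2) * φ₁) = 1 := by linarith
      rw [hc, hdM] at hd
      push_cast at hd
      have e : (((K - 1 : ℕ) : ℝ) * (2 * m + 2) + (2 * M + 2)) * Real.cos φ₁ = 0 := by
        linear_combination hd - ((K - 1 : ℕ) : ℝ) * hdm
      exact (mul_pos (by positivity) hcos).ne' e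
  have hM0 : 0 < M := hi k₀ hk₀
  have hMφ : 2 * (M : ℝ) * φ₁ = (K - 1 : ℕ) * Real.pi := by
    rw [hKm, ← ho₁]
    ring
  have hK2 : K = 2 := by
    by_contra hne
    -- Now 2Mφ₁ ≥ 2π > 2M · 2α, so the second zero 2 cos 2α of the same factor is also above y₁,
    -- against uniqueness.
    have hK3 : (2 : ℝ) ≤ (K - 1 : ℕ) := by exact_mod_cast (by omega : 2 ≤ K - 1)
    have hr : (chebP (2 * M)).eval (2 * Real.cos (2 * α k₀)) = 0 := by
      have := chebP_eval_eq_zero (n := 2 * M) (l := 2) two_pos (by omega)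
      rw [← this]
      simp only [hα]
      congr 3
      push_cast
      ring
    have hMR : (1 : ℝ) ≤ M := by exact_mod_cast hM0
    have hlt : 2 * α k₀ < φ₁ := by
      have e := hαe k₀
      have := hα0 k₀
      have h' : 2 * (M : ℝ) * (2 * α k₀) < 2 * M * φ₁ := by
        rw [hMφ]
        nlinarith
      exact lt_of_mul_lt_mul_left h' (by positivity)
    have hα0' := hα0 k₀
    have := (huniq' k₀ hk₀ k₀ hk₀ _ (2 * Real.cos (2 * α k₀)) hk₀y
      (by rw [hφ₁, two_mul_cos_lt_iff hφ₁0.le hφ₁π.le (by linarith) (by linarith)]; exact hlt)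
      (hαr k₀ hk₀) hr).2
    have hlt' := (two_mul_cos_lt_iff (a := 2 * α k₀) (b := α k₀) (by linarith) (by linarith)
      hα0'.le (hαπ k₀ hk₀).le).2 (by linarith)
    linarith
  refine ⟨hK2, ?_⟩
  subst hK2
  have hMm : M = m + 1 := by
    have : (M : ℝ) = m + 1 := by simpa using hKm
    exact_mod_cast this
  rw [Finset.mem_Icc] at hk₀ hl₀
  have hcase : (k₀ = 1 ∧ l₀ = 2) ∨ (k₀ = 2 ∧ l₀ = 1) := by omega
  rcases hcase with ⟨rfl, rfl⟩ | ⟨rfl, rfl⟩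
  · rw [← hM, ← hm, hMm]
    simp
  · rw [← hM, ← hm, hMm]
    simp

/-! ### Factorizations in the three cases -/

theorem eq_of_eval_two_mul_cos_eq {f g : ℝ[X]}
    (h : ∀ θ, 0 < Real.sin θ → f.eval (2 * Real.cos θ) = g.eval (2 * Real.cos θ)) : f = g := by
  refine eq_of_infinite_eval_eq f g
    ((Set.Ioo_infinite (show (-2 : ℝ) < 2 by norm_num)).mono fun x hx => ?_)
  have hc : Real.cos (Real.arccos (x / 2)) = x / 2 :=
    Real.cos_arccos (by linarith [hx.1]) (by linarith [hx.2])
  have hs : 0 < Real.sin (Real.arccos (x / 2)) := by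
    rw [Real.sin_arccos]
    exact Real.sqrt_pos.2 (by nlinarith [hx.1, hx.2])
  have := h _ hs
  rwa [hc, mul_div_cancel₀ _ two_ne_zero] at this

/-- Sum-to-product: sin((2j+1)θ) + sin θ = 2 sin((j+1)θ) cos(jθ). -/
theorem chebP_two_mul_add_one (j : ℕ) :
    chebP (2 * j) + 1 = chebP j * Chebyshev.C ℝ j := by
  refine eq_of_eval_two_mul_cos_eq fun θ hs => mul_right_cancel₀ hs.ne' ?_
  rw [eval_add, eval_one, eval_mul, add_mul, chebP_eval_two_mul_cos,
    Chebyshev.C_two_mul_real_cos, mul_right_comm, chebP_eval_two_mul_cos]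
  push_cast
  rw [show (2 * (j : ℝ) + 1) * θ = (j + 1) * θ + j * θ by ring, Real.sin_add,
    show Real.sin θ = Real.sin ((j + 1) * θ - j * θ) by ring_nf, Real.sin_sub]
  ring

theorem chebP_two_mul_sub_one (j : ℕ) :
    chebP (2 * (j + 1)) - 1 = chebP j * Chebyshev.C ℝ (j + 2 : ℕ) := by
  refine eq_of_eval_two_mul_cos_eq fun θ hs => mul_right_cancel₀ hs.ne' ?_
  rw [eval_sub, eval_one, eval_mul, sub_mul, chebP_eval_two_mul_cos,
    Chebyshev.C_two_mul_real_cos, mul_right_comm, chebP_eval_two_mul_cos]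
  push_cast
  rw [show (2 * ((j : ℝ) + 1) + 1) * θ = (j + 2) * θ + (j + 1) * θ by ring, Real.sin_add,
    show Real.sin θ = Real.sin ((j + 2) * θ - (j + 1) * θ) by ring_nf, Real.sin_sub]
  ring

/-- A Cassini-type identity, equivalent through the recurrence to S_n² + S_{n+1}² - X S_n S_{n+1} =
1. -/
theorem chebP_mul_add_one (j : ℕ) :
    chebP (2 * j) * chebP (2 * (j + 1)) + 1 = chebP (2 * j + 1) ^ 2 := by
  have := Chebyshev.S_sq_add_S_sq ℝ (2 * j : ℕ)
  have h2 := Chebyshev.S_add_two ℝ (2 * j : ℕ)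
  have e : ((2 * (j + 1) : ℕ) : ℤ) = ((2 * j : ℕ) : ℤ) + 2 := by push_cast; ring
  have e1 : ((2 * j + 1 : ℕ) : ℤ) = ((2 * j : ℕ) : ℤ) + 1 := by push_cast; ring
  rw [chebP, chebP, chebP, e, e1, h2]
  linear_combination -this

theorem Chebyshev_C_natDegree_monic {n : ℕ} (hn : 0 < n) :
    (Chebyshev.C ℝ n).natDegree = n ∧ (Chebyshev.C ℝ n).Monic := by
  have h2 : (2 * X : ℝ[X]) = C 2 * X := by rw [map_ofNat]
  have hd2 : (2 * X : ℝ[X]).natDegree = 1 := by rw [h2]; exact natDegree_C_mul_X 2 two_ne_zero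
  have hl2 : (2 * X : ℝ[X]).leadingCoeff = 2 := by rw [h2]; simp
  have hc := Chebyshev.C_comp_two_mul_X ℝ (n : ℤ)
  rw [show (2 * Chebyshev.T ℝ n : ℝ[X]) = C 2 * Chebyshev.T ℝ n by rw [map_ofNat]] at hc
  have hd : (Chebyshev.C ℝ n).natDegree = n := by
    have := congrArg natDegree hc
    rwa [natDegree_comp, hd2, mul_one, natDegree_C_mul two_ne_zero, Chebyshev.natDegree_T,
      Int.natAbs_natCast] at this
  refine ⟨hd, ?_⟩
  have := congrArg leadingCoeff hc
  rw [leadingCoeff_comp (by rw [hd2]; exact one_ne_zero), hl2, hd, leadingCoeff_mul,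
    leadingCoeff_C, Chebyshev.leadingCoeff_T, Int.natAbs_natCast, ← pow_succ',
    Nat.sub_add_cancel hn] at this
  exact mul_right_cancel₀ (pow_ne_zero n two_ne_zero) (this.trans (one_mul _).symm)

/-! ### Explicit root multisets -/

theorem roots_eq_sum_two_mul_cos {n : ℕ} {s : Finset ℕ} (hs : ∀ k ∈ s, k ≤ n) {f : ℝ[X]}
    (hf : f.Monic) (hd : f.natDegree = s.card)
    (h : ∀ k ∈ s, f.eval (2 * Real.cos (Real.pi * k / n)) = 0) :
    f.roots = ∑ k ∈ s, {2 * Real.cos (Real.pi * k / n)} := by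
  have hinj : Set.InjOn (fun k : ℕ => 2 * Real.cos (Real.pi * k / n)) s := by
    intro k hk l hl hkl
    have hpi := Real.pi_pos
    rcases Nat.eq_zero_or_pos n with rfl | hn
    · have := hs k hk
      have := hs l hl
      omega
    have hnR : (0 : ℝ) < n := by exact_mod_cast hn
    have hmem : ∀ t ∈ s, Real.pi * t / n ∈ Set.Icc 0 Real.pi := by
      intro t ht
      have : (t : ℝ) ≤ n := by exact_mod_cast hs t ht
      refine ⟨by positivity, ?_⟩
      rw [div_le_iff₀ hnR]
      gcongr
    have := Real.injOn_cos (hmem k hk) (hmem l hl) (mul_left_cancel₀ two_ne_zero hkl)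
    field_simp at this
    exact_mod_cast this
  rw [roots_eq_of_degree_eq_card (S := s.image fun k : ℕ => 2 * Real.cos (Real.pi * k / n)) ?_ ?_,
    Finset.image_val_of_injOn hinj]
  · rw [← Multiset.sum_map_singleton (Multiset.map _ s.val), Multiset.map_map]
    rfl
  · intro x hx
    obtain ⟨k, hk, rfl⟩ := Finset.mem_image.1 hx
    exact h k hk
  · rw [Finset.card_image_of_injOn hinj, degree_eq_natDegree hf.ne_zero, hd]

theorem card_filter_even (n : ℕ) :
    ((Finset.Ico 1 (2 * (n + 1))).filter fun k => k % 2 = 0).card = n := by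
  have : ((Finset.Ico 1 (2 * (n + 1))).filter fun k => k % 2 = 0) =
      (Finset.range n).image fun k => 2 * k + 2 := by
    ext k
    simp only [Finset.mem_filter, Finset.mem_Ico, Finset.mem_image, Finset.mem_range]
    exact ⟨fun h => ⟨k / 2 - 1, by omega, by omega⟩, fun ⟨a, ha, e⟩ => by omega⟩
  rw [this, Finset.card_image_of_injective _ fun a b (h : 2 * a + 2 = 2 * b + 2) => by omega,
    Finset.card_range]

theorem card_filter_odd (n : ℕ) :
    ((Finset.Ico 1 (2 * n)).filter fun k => k % 2 = 1).card = n := by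
  have : ((Finset.Ico 1 (2 * n)).filter fun k => k % 2 = 1) =
      (Finset.range n).image fun k => 2 * k + 1 := by
    ext k
    simp only [Finset.mem_filter, Finset.mem_Ico, Finset.mem_image, Finset.mem_range]
    exact ⟨fun h => ⟨k / 2, by omega, by omega⟩, fun ⟨a, ha, e⟩ => by omega⟩
  rw [this, Finset.card_image_of_injective _ fun a b (h : 2 * a + 1 = 2 * b + 1) => by omega,
    Finset.card_range]

/-- Doubling the index puts the zeros of P_n and C_n in one form, selected by the parity of k; this
parity becomes the sign (-1)^(k+p). -/
theorem roots_chebP_even_index (n : ℕ) :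
    (chebP n).roots = ∑ k ∈ Finset.Ico 1 (2 * (n + 1)),
      if k % 2 = 0 then {2 * Real.cos (Real.pi * k / (2 * (n + 1) : ℕ))} else 0 := by
  rw [← Finset.sum_filter]
  refine roots_eq_sum_two_mul_cos (fun k hk => ?_) (chebP_monic n)
    (by rw [chebP_natDegree, card_filter_even]) fun k hk => ?_
  all_goals rw [Finset.mem_filter, Finset.mem_Ico] at hk
  · omega
  · have := chebP_eval_eq_zero (n := n) (l := k / 2) (by omega) (by omega)
    rw [← this]
    congr 3
    have hk2 : (k : ℝ) = 2 * (k / 2 : ℕ) := by exact_mod_cast (by omega : k = 2 * (k / 2))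
    rw [hk2]
    push_cast
    field_simp

theorem roots_chebyshev_C_odd_index {n : ℕ} (hn : 0 < n) :
    (Chebyshev.C ℝ n).roots = ∑ k ∈ Finset.Ico 1 (2 * n),
      if k % 2 = 1 then {2 * Real.cos (Real.pi * k / (2 * n : ℕ))} else 0 := by
  rw [← Finset.sum_filter]
  refine roots_eq_sum_two_mul_cos (fun k hk => ?_) (Chebyshev_C_natDegree_monic hn).2
    (by rw [(Chebyshev_C_natDegree_monic hn).1, card_filter_odd]) fun k hk => ?_
  all_goals rw [Finset.mem_filter, Finset.mem_Ico] at hk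
  · omega
  · rw [Chebyshev.C_two_mul_real_cos]
    have hk2 : (k : ℝ) = 2 * (k / 2 : ℕ) + 1 := by
      exact_mod_cast (by omega : k = 2 * (k / 2) + 1)
    have hnR : (n : ℝ) ≠ 0 := by positivity
    have e : ((n : ℤ) : ℝ) * (Real.pi * k / (2 * n : ℕ)) = Real.pi / 2 + (k / 2 : ℕ) * Real.pi := by
      rw [hk2]
      push_cast
      field_simp
      ring
    rw [e, Real.cos_add_nat_mul_pi, Real.cos_pi_div_two, mul_zero, mul_zero]

theorem sum_Ico_fold {M : Type*} [AddCommMonoid M] (G : ℕ → M) {n : ℕ} (hn : 0 < n) :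
    ∑ k ∈ Finset.Ico 1 (2 * n), G k = ∑ k ∈ Finset.Ico 1 n, (G k + G (2 * n - k)) + G n := by
  have hr := Finset.sum_Ico_reflect G 1 (m := n) (n := 2 * n) (by omega)
  rw [show 2 * n + 1 - n = n + 1 by omega, Nat.add_sub_cancel] at hr
  rw [Finset.sum_add_distrib, hr, ← Finset.sum_Ico_consecutive G (n := n) (by omega) (by omega),
    Finset.sum_eq_sum_Ico_succ_bot (by omega : n < 2 * n) G]
  abel

theorem cos_reflect {n k : ℕ} (hn : 0 < n) (hk : k ≤ 2 * n) :
    2 * Real.cos (Real.pi * (2 * n - k : ℕ) / (2 * n : ℕ)) =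
      -(2 * Real.cos (Real.pi * k / (2 * n : ℕ))) := by
  have hnR : (n : ℝ) ≠ 0 := by positivity
  rw [← mul_neg, ← Real.cos_pi_sub]
  congr 2
  rw [Nat.cast_sub hk]
  push_cast
  field_simp

/-- The reflection k ↦ 2n - k preserves parity and negates the cosine; the fixed index k = n
contributes the single entry 0. -/
theorem sum_two_mul_cos_parity {n : ℕ} (hn : 0 < n) (q : ℕ) :
    (∑ k ∈ Finset.Ico 1 (2 * n),
      if k % 2 = q then ({2 * Real.cos (Real.pi * k / (2 * n : ℕ))} : Multiset ℝ) else 0) =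
    (∑ k ∈ Finset.Ico 1 n, if k % 2 = q then pmTwoCos (Real.pi * k / (2 * n : ℕ)) else 0) +
      if n % 2 = q then {0} else 0 := by
  have hnR : (n : ℝ) ≠ 0 := by positivity
  rw [sum_Ico_fold _ hn]
  congr 1
  · refine Finset.sum_congr rfl fun k hk => ?_
    rw [Finset.mem_Ico] at hk
    rw [cos_reflect hn (by omega), show (2 * n - k) % 2 = k % 2 by omega]
    split_ifs
    · rfl
    · rw [add_zero]
  · have : Real.pi * n / (2 * n : ℕ) = Real.pi / 2 := by push_cast; field_simp
    rw [this, Real.cos_pi_div_two, mul_zero]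

theorem pmTwoCos_pi_div_two : pmTwoCos (Real.pi / 2) = {0} + {0} := by
  simp [pmTwoCos]

theorem sum_pmTwoCos_eq {j p : ℕ} (hj : 0 < j) (hp : p = 0 ∨ p = 1) :
    ∑ k ∈ Finset.Icc 1 j, pmTwoCos (Real.pi * (k : ℝ) / (2 * (j : ℝ) + 1 + (-1) ^ (k + p))) =
    (∑ k ∈ Finset.Ico 1 (2 * (j + 1)),
      if k % 2 = p then {2 * Real.cos (Real.pi * k / (2 * (j + 1) : ℕ))} else 0) +
    ∑ k ∈ Finset.Ico 1 (2 * j),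
      if k % 2 = 1 - p then {2 * Real.cos (Real.pi * k / (2 * j : ℕ))} else 0 := by
  have hjR : (j : ℝ) ≠ 0 := by positivity
  have hterm : ∀ k : ℕ, pmTwoCos (Real.pi * (k : ℝ) / (2 * (j : ℝ) + 1 + (-1) ^ (k + p))) =
      (if k % 2 = p then pmTwoCos (Real.pi * k / (2 * (j + 1) : ℕ)) else 0) +
      if k % 2 = 1 - p then pmTwoCos (Real.pi * k / (2 * j : ℕ)) else 0 := by
    intro k
    by_cases hk : k % 2 = p
    · rw [if_pos hk, if_neg (by omega), add_zero,
        (Nat.even_iff.2 (by omega : (k + p) % 2 = 0)).neg_one_pow]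
      congr 2
      push_cast
      ring
    · rw [if_neg hk, if_pos (by omega), zero_add,
        (Nat.odd_iff.2 (by omega : (k + p) % 2 = 1)).neg_one_pow]
      congr 2
      push_cast
      ring
  have hlast : pmTwoCos (Real.pi * j / (2 * j : ℕ)) = {0} + {0} := by
    rw [← pmTwoCos_pi_div_two]
    congr 1
    push_cast
    field_simp
  rw [Finset.sum_congr rfl fun k _ => hterm k, Finset.sum_add_distrib,
    sum_two_mul_cos_parity j.succ_pos, sum_two_mul_cos_parity hj,
    show Finset.Icc 1 j = Finset.Ico 1 (j + 1) from rfl, add_assoc]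
  congr 1
  -- The two middle zeros, one from each parity sum, occur under the same condition on j and
  -- together form the entry ±0 at k = j.
  rw [Finset.sum_Ico_succ_top hj, hlast, Nat.cast_mul]
  by_cases h : j % 2 = 1 - p
  · rw [if_pos h, if_pos h, if_pos (by omega)]
    abel
  · rw [if_neg h, if_neg h, if_neg (by omega)]
    abel

theorem roots_chebP_two_mul_add {j p : ℕ} (hj : 0 < j) (hp : p = 0 ∨ p = 1) :
    (chebP (2 * j) + (-1) ^ p).roots =
      ∑ k ∈ Finset.Icc 1 j,
        pmTwoCos (Real.pi * (k : ℝ) / (2 * (j : ℝ) + 1 + (-1) ^ (k + p))) := by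
  rw [sum_pmTwoCos_eq hj hp]
  have hmul : ∀ a b : ℕ, 0 < b → chebP a * Chebyshev.C ℝ b ≠ 0 := fun a b hb =>
    mul_ne_zero (chebP_monic a).ne_zero (Chebyshev_C_natDegree_monic hb).2.ne_zero
  rcases hp with rfl | rfl
  · rw [pow_zero, chebP_two_mul_add_one, roots_mul (hmul j j hj), roots_chebP_even_index,
      roots_chebyshev_C_odd_index hj]
  · obtain ⟨j, rfl⟩ : ∃ t, j = t + 1 := ⟨j - 1, by omega⟩
    rw [pow_one, ← sub_eq_add_neg, chebP_two_mul_sub_one, roots_mul (hmul _ _ (by omega)),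
      roots_chebP_even_index, roots_chebyshev_C_odd_index (by omega), add_comm]

theorem card_pmTwoCos (θ : ℝ) : (pmTwoCos θ).card = 2 := by
  simp [pmTwoCos]

theorem hasOnlyRealRoots_of_card_roots {f : ℝ[X]} (hf : f ≠ 0) (h : f.roots.card = f.natDegree) :
    HasOnlyRealRoots f := by
  intro z hz
  obtain ⟨x, rfl⟩ := (splits_iff_card_roots.2 h).mem_range_of_isRoot hf (i := algebraMap ℝ ℂ)
    (x := z) (by rw [IsRoot, eval_map, ← aeval_def]; exact hz)
  simp

theorem roots_chebP_sq (j : ℕ) :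
    (chebP (2 * j + 1) ^ 2).roots =
      ∑ k ∈ Finset.Icc 1 (2 * (j + 1) - 1),
        pmTwoCos (Real.pi * (k : ℝ) / (2 * ((j + 1 : ℕ) : ℝ))) := by
  have hIcc : Finset.Icc 1 (2 * (j + 1) - 1) = Finset.Ico 1 (2 * (j + 1)) := by
    ext k
    simp only [Finset.mem_Icc, Finset.mem_Ico]
    omega
  have hr : (chebP (2 * j + 1)).roots =
      ∑ k ∈ Finset.Ico 1 (2 * (j + 1)), {2 * Real.cos (Real.pi * k / (2 * (j + 1) : ℕ))} := by
    refine roots_eq_sum_two_mul_cos (fun k hk => (Finset.mem_Ico.1 hk).2.le) (chebP_monic _)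
      (by rw [chebP_natDegree, Nat.card_Ico]; omega) fun k hk => ?_
    rw [Finset.mem_Ico] at hk
    rw [← chebP_eval_eq_zero (n := 2 * j + 1) (l := k) (by omega) (by omega)]
    congr 3
    push_cast
    ring
  -- The root multiset is symmetric, so one of the two copies in the square can be negated to form
  -- the ± pairs.
  have hneg : ∑ k ∈ Finset.Ico 1 (2 * (j + 1)),
        ({2 * Real.cos (Real.pi * k / (2 * (j + 1) : ℕ))} : Multiset ℝ) =
      ∑ k ∈ Finset.Ico 1 (2 * (j + 1)),
        {-(2 * Real.cos (Real.pi * k / (2 * (j + 1) : ℕ)))} := by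
    have := Finset.sum_Ico_reflect
      (fun k : ℕ => ({2 * Real.cos (Real.pi * k / (2 * (j + 1) : ℕ))} : Multiset ℝ)) 1
      (m := 2 * (j + 1)) (n := 2 * (j + 1)) (by omega)
    rw [Nat.add_sub_cancel, Nat.add_sub_cancel_left] at this
    rw [← this]
    refine Finset.sum_congr rfl fun k hk => ?_
    rw [cos_reflect j.succ_pos (Finset.mem_Ico.1 hk).2.le]
  rw [roots_pow, two_nsmul, hIcc]
  nth_rewrite 2 [hr]
  rw [hneg, hr, ← Finset.sum_add_distrib]
  refine Finset.sum_congr rfl fun k _ => ?_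
  rw [Nat.cast_mul]
  rfl

/-! ### The three cases and the main theorem -/

section Cases

variable {K : ℕ} {i : ℕ → ℕ} {p : ℕ}

theorem roots_chebH_single (hK : K = 1) (hi : 0 < i 1) (hp : p = 0 ∨ p = 1) :
    (chebH K i p).roots =
      ∑ k ∈ Finset.Icc 1 (i 1),
        pmTwoCos (Real.pi * (k : ℝ) / (2 * (i 1 : ℝ) + 1 + (-1) ^ (k + p))) := by
  rw [← roots_chebP_two_mul_add hi hp, hK, chebH, Finset.Icc_self, Finset.prod_singleton]

theorem chebH_two (i : ℕ → ℕ) (p : ℕ) :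
    chebH 2 i p = chebP (2 * i 1) * chebP (2 * i 2) + (-1) ^ p := by
  rw [chebH, show Finset.Icc 1 2 = {1, 2} from rfl, Finset.prod_pair (by decide)]

theorem roots_chebH_equal (h : K = 2 ∧ i 1 = i 2 ∧ p = 1) (hi : 0 < i 1) :
    (chebH K i p).roots =
      ∑ k ∈ Finset.Icc 1 (i 1),
        (pmTwoCos (Real.pi * (k : ℝ) / (2 * (i 1 : ℝ))) +
          pmTwoCos (Real.pi * (k : ℝ) / (2 * (i 1 : ℝ) + 2))) := by
  obtain ⟨rfl, h12, rfl⟩ := h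
  have hfac : chebH 2 i 1 = (chebP (2 * i 1) + (-1) ^ 0) * (chebP (2 * i 1) + (-1) ^ 1) := by
    rw [chebH_two, ← h12]
    ring
  have hne : chebH 2 i 1 ≠ 0 := by
    refine (monic_chebH one_le_two (fun k hk => ?_) 1).1.ne_zero
    rw [Finset.mem_Icc] at hk
    have : k = 1 ∨ k = 2 := by omega
    rcases this with rfl | rfl <;> omega
  rw [hfac] at hne ⊢
  rw [roots_mul hne, roots_chebP_two_mul_add hi (Or.inl rfl),
    roots_chebP_two_mul_add hi (Or.inr rfl), ← Finset.sum_add_distrib]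
  refine Finset.sum_congr rfl fun k _ => ?_
  -- For each k the factors P + 1 and P - 1 supply the denominators 2j and 2j+2, in an order given
  -- by the parity of k.
  rcases neg_one_pow_eq_or ℝ k with hk | hk
  · rw [pow_add, pow_add, hk, pow_zero, pow_one, add_comm]
    congr 3 <;> ring
  · rw [pow_add, pow_add, hk, pow_zero, pow_one]
    congr 3 <;> ring

theorem roots_chebH_consecutive (h : K = 2 ∧ |(i 1 : ℤ) - (i 2 : ℤ)| = 1 ∧ p = 0) :
    (chebH K i p).roots =
      ∑ k ∈ Finset.Icc 1 (2 * max (i 1) (i 2) - 1),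
        pmTwoCos (Real.pi * (k : ℝ) / (2 * ((max (i 1) (i 2) : ℕ) : ℝ))) := by
  obtain ⟨rfl, h12, rfl⟩ := h
  have hcase : i 2 = i 1 + 1 ∨ i 1 = i 2 + 1 := by
    rcases (abs_eq zero_le_one).1 h12 with h | h <;> omega
  rw [chebH_two, pow_zero]
  rcases hcase with h | h
  · rw [max_eq_right (by omega), h, chebP_mul_add_one, roots_chebP_sq]
  · rw [max_eq_left (by omega), h, mul_comm (chebP _), chebP_mul_add_one, roots_chebP_sq]

end Cases

/-- When `h = ∏_{k=1}^K P_{2 i_k} + (-1)^p` has only real roots, with the roots in each case listed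
with their multiplicities (`Polynomial.roots` is the multiset of roots). -/
theorem theorem5 (K : ℕ) (hK : 1 ≤ K) (i : ℕ → ℕ) (hi : ∀ k ∈ Finset.Icc 1 K, 0 < i k)
    (p : ℕ) (hp : p = 0 ∨ p = 1) :
    (HasOnlyRealRoots (chebH K i p) ↔
      K = 1 ∨
      (K = 2 ∧ i 1 = i 2 ∧ p = 1) ∨
      (K = 2 ∧ |(i 1 : ℤ) - (i 2 : ℤ)| = 1 ∧ p = 0)) ∧
    (K = 1 → ∀ j : ℕ, j = i 1 →
      (chebH K i p).roots =
        ∑ k ∈ Finset.Icc 1 j,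
          pmTwoCos (Real.pi * (k : ℝ) / (2 * (j : ℝ) + 1 + (-1) ^ (k + p)))) ∧
    (K = 2 ∧ i 1 = i 2 ∧ p = 1 → ∀ j : ℕ, j = i 1 →
      (chebH K i p).roots =
        ∑ k ∈ Finset.Icc 1 j,
          (pmTwoCos (Real.pi * (k : ℝ) / (2 * (j : ℝ))) +
            pmTwoCos (Real.pi * (k : ℝ) / (2 * (j : ℝ) + 2)))) ∧
    (K = 2 ∧ |(i 1 : ℤ) - (i 2 : ℤ)| = 1 ∧ p = 0 → ∀ j : ℕ, j = max (i 1) (i 2) →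
      (chebH K i p).roots =
        ∑ k ∈ Finset.Icc 1 (2 * j - 1),
          pmTwoCos (Real.pi * (k : ℝ) / (2 * (j : ℝ)))) := by
  have h1 : 1 ∈ Finset.Icc 1 K := Finset.mem_Icc.2 ⟨le_rfl, hK⟩
  have hi1 := hi 1 h1
  have hmon := monic_chebH hK hi p
  refine ⟨⟨fun h => ?_, fun h => hasOnlyRealRoots_of_card_roots hmon.1.ne_zero ?_⟩, ?_, ?_, ?_⟩
  · by_cases hK1 : K = 1
    · exact Or.inl hK1
    have hK2 : 2 ≤ K := by omega
    right
    rcases hp with rfl | rfl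
    · have := indices_of_hasOnlyRealRoots_zero hK2 hi h
      exact Or.inr ⟨this.1, this.2, rfl⟩
    · have hle := card_le_two_of_hasOnlyRealRoots_one hK hi h
      exact Or.inl ⟨by omega, indices_eq_of_hasOnlyRealRoots_one hK hi h 1 h1 2
        (Finset.mem_Icc.2 ⟨one_le_two, hK2⟩), rfl⟩
  · rw [hmon.2]
    rcases h with h | h | h
    · rw [roots_chebH_single h hi1 hp, Multiset.card_sum, h]
      simp [card_pmTwoCos, mul_comm]
    · rw [roots_chebH_equal h hi1, Multiset.card_sum]
      obtain ⟨rfl, h12, -⟩ := h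
      rw [show Finset.Icc 1 2 = {1, 2} from rfl, Finset.sum_pair (by decide), ← h12]
      simp [card_pmTwoCos]
      ring
    · rw [roots_chebH_consecutive h, Multiset.card_sum]
      obtain ⟨rfl, h12, -⟩ := h
      rw [show Finset.Icc 1 2 = {1, 2} from rfl, Finset.sum_pair (by decide)]
      simp only [card_pmTwoCos, Finset.sum_const, Nat.card_Icc, smul_eq_mul]
      rcases (abs_eq zero_le_one).1 h12 with h | h <;> omega
  · rintro h j rfl
    exact roots_chebH_single h hi1 hp
  · rintro h j rfl
    exact roots_chebH_equal h hi1
  · rintro h j rfl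
    exact roots_chebH_consecutive h
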